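/- Formulas are built from countably infinitely many propositional variables by $\top,\bot,\wedge,\vee,\to$, coimplication $\mathbin{-\!\!\!<}$, and unary modalities $\blacklozenge,\Box$. An $H$-frame $F=(U,H,R)$ consists of a nonempty set $U$, a preorder $H$ on $U$ and a relation $R$ on $U$ that is stable: $uHu'$, $u'Rv'$ and $v'Hv$ imply $uRv$. A valuation $V$ assigns to each variable an $H$-set, i.e. a subset of $U$ closed under $H$-successors. Satisfaction is as usual for $\top,\bot,\wedge,\vee$ and variables, and $u\models\varphi\to\psi$ iff for all $v$ with $uHv$, $v\models\varphi$ implies $v\models\psi$; $u\models\varphi\mathbin{-\!\!\!<}\psi$ iff for some $v$ with $vHu$, $v\models\varphi$ and $v\not\models\psi$; $u\models\blacklozenge\varphi$ iff $v\models\varphi$ for some $v$ with $vRu$; $u\models\Box\varphi$ iff $v\models\varphi$ for all $v$ with $uRv$. A formula is valid in $F$, $F\models\varphi$, if it is true at every state under every valuation. A bist-logic is a set of formulas that contains the axioms $p\to(q\to p)$, $(p\to(q\to r))\to((p\to q)\to(p\to r))$, $p\to p\vee q$, $q\to p\vee q$, $(p\to r)\to((q\to r)\to(p\vee q\to r))$,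 $p\wedge q\to p$, $p\wedge q\to q$, $p\to(q\to p\wedge q)$, $\bot\to p$, $p\to\top$, $p\to(q\vee(p\mathbin{-\!\!\!<}q))$, $((q\vee r)\mathbin{-\!\!\!<}q)\to r$, $p\to\Box\blacklozenge p$, $\blacklozenge\Box p\to p$, and is closed under modus ponens, uniform substitution and the rules: from $\delta_1\to\delta_2$ infer $(\delta_1\mathbin{-\!\!\!<}\psi)\to(\delta_2\mathbin{-\!\!\!<}\psi)$; from $\varphi\to\psi$ infer $\Box\varphi\to\Box\psi$; from $\varphi\to\psi$ infer $\blacklozenge\varphi\to\blacklozenge\psi$. For a set $\Sigma$ of formulas, $\mathbf{BiSKt}\Sigma$ is the smallest bist-logic containing $\Sigma$. A bist-logic $\Lambda$ has the finite model property if for every formula $\varphi\notin\Lambda$ there is an $H$-frame $F$ with finite underlying set such that every formula of $\Lambda$ is valid in $F$ but $\varphi$ is not. Theorem. Let $p$ be a propositional variable. The logics $\mathbf{BiSKt}\{\blacklozenge\blacklozenge p\to\blacklozenge p\}$ and $\mathbf{BiSKt}\{\blacklozenge\blacklozenge p\to\blacklozenge p,\ p\to\blacklozenge p\}$ have the finite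 model property and are decidable (their sets of theorems are computable). -/

import Mathlib

/-- Formulas of the language `L(◆, □)` of bi-intuitionistic stable tense logic, over the countably
infinite set `{var 0, var 1, …}` of propositional variables. `coimp φ ψ` is the coimplication
`φ ⤙ ψ`, `bdia` is the black diamond `◆` (looking backwards along `R`). -/
inductive Form : Type where
  | top : Form
  | bot : Form
  | var : ℕ → Form
  | and : Form → Form → Form
  | or : Form → Form → Form
  | imp : Form → Form → Form
  | coimp : Form → Form → Form
  | bdia : Form → Form
  | box : Form → Form

namespace Form

/-- Uniform substitution of formulas for propositional variables. -/
def subst (σ : ℕ → Form) : Form → Form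
  | top => top
  | bot => bot
  | var n => σ n
  | and φ ψ => and (φ.subst σ) (ψ.subst σ)
  | or φ ψ => or (φ.subst σ) (ψ.subst σ)
  | imp φ ψ => imp (φ.subst σ) (ψ.subst σ)
  | coimp φ ψ => coimp (φ.subst σ) (ψ.subst σ)
  | bdia φ => bdia (φ.subst σ)
  | box φ => box (φ.subst σ)

/-! An explicit bijective Gödel numbering of formulas; it makes the notion of a computable set of
formulas available. -/

/-- The Gödel number of a formula. -/
def toNat : Form → ℕ
  | top => 0
  | bot => 1
  | var n => 7 * n + 2
  | and φ ψ => 7 * Nat.pair φ.toNat ψ.toNat + 3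
  | or φ ψ => 7 * Nat.pair φ.toNat ψ.toNat + 4
  | imp φ ψ => 7 * Nat.pair φ.toNat ψ.toNat + 5
  | coimp φ ψ => 7 * Nat.pair φ.toNat ψ.toNat + 6
  | bdia φ => 7 * φ.toNat + 7
  | box φ => 7 * φ.toNat + 8

/-- The formula with a given Gödel number. -/
def ofNat : ℕ → Form
  | 0 => top
  | 1 => bot
  | n + 2 =>
    have hm : n / 7 < n + 2 := lt_of_le_of_lt (Nat.div_le_self n 7) (by omega)
    have h1 : (n / 7).unpair.1 < n + 2 := lt_of_le_of_lt (Nat.unpair_left_le _) hm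
    have h2 : (n / 7).unpair.2 < n + 2 := lt_of_le_of_lt (Nat.unpair_right_le _) hm
    match n % 7 with
    | 0 => var (n / 7)
    | 1 => and (ofNat (n / 7).unpair.1) (ofNat (n / 7).unpair.2)
    | 2 => or (ofNat (n / 7).unpair.1) (ofNat (n / 7).unpair.2)
    | 3 => imp (ofNat (n / 7).unpair.1) (ofNat (n / 7).unpair.2)
    | 4 => coimp (ofNat (n / 7).unpair.1) (ofNat (n / 7).unpair.2)
    | 5 => bdia (ofNat (n / 7))
    | _ => box (ofNat (n / 7))

theorem ofNat_toNat (φ : Form) : ofNat φ.toNat = φ := by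
  have hd : ∀ m k : ℕ, k < 7 → (7 * m + k) / 7 = m ∧ (7 * m + k) % 7 = k := by
    intro m k hk
    omega
  induction φ with
  | top => simp [toNat, ofNat]
  | bot => simp [toNat, ofNat]
  | var n => simp [toNat, ofNat]
  | and φ ψ h1 h2 =>
    have := hd (Nat.pair φ.toNat ψ.toNat) 1 (by norm_num)
    simp [toNat, ofNat, this, h1, h2]
  | or φ ψ h1 h2 =>
    have := hd (Nat.pair φ.toNat ψ.toNat) 2 (by norm_num)
    simp [toNat, ofNat, this, h1, h2]
  | imp φ ψ h1 h2 =>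
    have := hd (Nat.pair φ.toNat ψ.toNat) 3 (by norm_num)
    simp [toNat, ofNat, this, h1, h2]
  | coimp φ ψ h1 h2 =>
    have := hd (Nat.pair φ.toNat ψ.toNat) 4 (by norm_num)
    simp [toNat, ofNat, this, h1, h2]
  | bdia φ h =>
    have := hd φ.toNat 5 (by norm_num)
    simp [toNat, ofNat, this, h]
  | box φ h =>
    have := hd φ.toNat 6 (by norm_num)
    simp [toNat, ofNat, this, h]

theorem toNat_ofNat (n : ℕ) : (ofNat n).toNat = n := by
  induction n using Nat.strong_induction_on with
  | _ n ih =>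
    match n with
    | 0 => simp [toNat, ofNat]
    | 1 => simp [toNat, ofNat]
    | n + 2 =>
      have hm : n / 7 < n + 2 := lt_of_le_of_lt (Nat.div_le_self n 7) (by omega)
      have h0 := ih _ hm
      have h1 := ih _ (lt_of_le_of_lt (Nat.unpair_left_le _) hm)
      have h2 := ih _ (lt_of_le_of_lt (Nat.unpair_right_le _) hm)
      have hk : n % 7 = 0 ∨ n % 7 = 1 ∨ n % 7 = 2 ∨ n % 7 = 3 ∨ n % 7 = 4 ∨ n % 7 = 5 ∨
        n % 7 = 6 := by omega
      rcases hk with hk | hk | hk | hk | hk | hk | hk <;>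
        simp only [ofNat, hk, toNat, h0, h1, h2, Nat.pair_unpair] <;> omega

instance instDenumerable : Denumerable Form :=
  Denumerable.mk' ⟨toNat, ofNat, ofNat_toNat, toNat_ofNat⟩

end Form

/-- An `H`-frame: a nonempty set `U` with a preorder `H` and a stable relation `R` on it. -/
structure HFrame where
  U : Type
  nonempty : Nonempty U
  H : U → U → Prop
  R : U → U → Prop
  refl : ∀ u, H u u
  trans : ∀ u v w, H u v → H v w → H u w
  stable : ∀ u u' v' v, H u u' → R u' v' → H v' v → R u v

namespace HFrame

/-- `X` is an `H`-set: it is closed under `H`-successors. -/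
def IsHSet (F : HFrame) (X : Set F.U) : Prop :=
  ∀ u v, F.H u v → u ∈ X → v ∈ X

/-- Satisfaction of a formula at a state of the model `(F, V)`. -/
def Sat (F : HFrame) (V : ℕ → Set F.U) : Form → F.U → Prop
  | .top, _ => True
  | .bot, _ => False
  | .var p, u => u ∈ V p
  | .and φ ψ, u => F.Sat V φ u ∧ F.Sat V ψ u
  | .or φ ψ, u => F.Sat V φ u ∨ F.Sat V ψ u
  | .imp φ ψ, u => ∀ v, F.H u v → F.Sat V φ v → F.Sat V ψ v
  | .coimp φ ψ, u => ∃ v, F.H v u ∧ F.Sat V φ v ∧ ¬ F.Sat V ψ v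
  | .bdia φ, u => ∃ v, F.R v u ∧ F.Sat V φ v
  | .box φ, u => ∀ v, F.R u v → F.Sat V φ v

/-- Validity in a frame: truth at all states under all valuations by `H`-sets. -/
def Valid (F : HFrame) (φ : Form) : Prop :=
  ∀ V : ℕ → Set F.U, (∀ p, F.IsHSet (V p)) → ∀ u, F.Sat V φ u

end HFrame

open Form in
/-- The axioms (A0)–(A13) of the Hilbert system, with `p = var 0`, `q = var 1`, `r = var 2`. -/
inductive HilbertAx : Form → Prop
  | a0 : HilbertAx (imp (var 0) (imp (var 1) (var 0)))
  | a1 : HilbertAx (imp (imp (var 0) (imp (var 1) (var 2)))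
      (imp (imp (var 0) (var 1)) (imp (var 0) (var 2))))
  | a2 : HilbertAx (imp (var 0) (or (var 0) (var 1)))
  | a3 : HilbertAx (imp (var 1) (or (var 0) (var 1)))
  | a4 : HilbertAx (imp (imp (var 0) (var 2))
      (imp (imp (var 1) (var 2)) (imp (or (var 0) (var 1)) (var 2))))
  | a5 : HilbertAx (imp (and (var 0) (var 1)) (var 0))
  | a6 : HilbertAx (imp (and (var 0) (var 1)) (var 1))
  | a7 : HilbertAx (imp (var 0) (imp (var 1) (and (var 0) (var 1))))
  | a8 : HilbertAx (imp bot (var 0))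
  | a9 : HilbertAx (imp (var 0) top)
  | a10 : HilbertAx (imp (var 0) (or (var 1) (coimp (var 0) (var 1))))
  | a11 : HilbertAx (imp (coimp (or (var 1) (var 2)) (var 1)) (var 2))
  | a12 : HilbertAx (imp (var 0) (box (bdia (var 0))))
  | a13 : HilbertAx (imp (bdia (box (var 0))) (var 0))

/-- A bi-intuitionistic stable tense logic (`bist`-logic): a set of formulas that contains the
axioms and is closed under the rules (MP), (US), (Mon⤙), (Mon□), (Mon◆). -/
structure IsBistLogic (L : Set Form) : Prop where
  ax : ∀ φ, HilbertAx φ → φ ∈ L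
  mp : ∀ φ ψ, φ ∈ L → Form.imp φ ψ ∈ L → ψ ∈ L
  us : ∀ φ (σ : ℕ → Form), φ ∈ L → φ.subst σ ∈ L
  monCoimp : ∀ δ₁ δ₂ ψ, Form.imp δ₁ δ₂ ∈ L → Form.imp (.coimp δ₁ ψ) (.coimp δ₂ ψ) ∈ L
  monBox : ∀ φ ψ, Form.imp φ ψ ∈ L → Form.imp (.box φ) (.box ψ) ∈ L
  monBdia : ∀ φ ψ, Form.imp φ ψ ∈ L → Form.imp (.bdia φ) (.bdia ψ) ∈ L

/-- `BiSKt S` is the smallest `bist`-logic that contains `S`. -/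
def BiSKt (S : Set Form) : Set Form :=
  ⋂₀ {L | IsBistLogic L ∧ S ⊆ L}

/-- The finite model property: every nontheorem is refuted on a finite frame on which all theorems
are valid. -/
def HasFMP (L : Set Form) : Prop :=
  ∀ φ, φ ∉ L → ∃ F : HFrame, Finite F.U ∧ (∀ ψ ∈ L, F.Valid ψ) ∧ ¬ F.Valid φ

/-- A logic is decidable if its set of theorems is computable (recursive). -/
def IsDecidableLogic (L : Set Form) : Prop :=
  ComputablePred (fun φ : Form => φ ∈ L)

/-- The formula `◆◆p → ◆p`. -/
def transForm (p : ℕ) : Form :=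
  .imp (.bdia (.bdia (.var p))) (.bdia (.var p))

/-- The formula `p → ◆p`. -/
def reflForm (p : ℕ) : Form :=
  .imp (.var p) (.bdia (.var p))

/-! ### Prime ideals in distributive lattices with residuated operations -/

section PrimeIdeals

open Order

/-! The proof filtrates the canonical model. Formulas modulo provable equivalence form a bi-Heyting
algebra with an adjunction `◆ ⊣ □`. Its prime theories, given as complements of prime ideals, are
the canonical states, and the prime ideal theorem supplies the witnesses for `→`, coimplication, `◆`
and `□`.

To refute a nontheorem with Gödel number `n`, each prime theory is cut down to its trace on the
formulas with number below `n + 1`, a set closed under subformulas. There are finitely many traces.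
They are ordered by inclusion and related by `Acc`: `α` or `◆α` in the source puts `◆α` in the
target, and `□α` in the source puts `α` and `□α` in the target. This relation is stable and
transitive by its form. The axiom `◆◆p → ◆p` makes it contain the canonical relation (`acc_trace`),
so the witnesses survive and the truth conditions hold (`coherent_trace`). With `p → ◆p` it is
reflexive.

Conversely, any family of sets obeying the truth conditions is a finite model on a frame for the
logic (`sat_frame_iff`), so soundness applies to it. Hence nontheoremhood means that some code below
`2 ^ 2 ^ (n + 1)` refutes the formula. This is a bounded search through a primitive recursive
condition, which gives decidability along with the finite model property. -/

theorem exists_isPrime_of_separated {α : Type*} [DistribLattice α] [BoundedOrder α] {F I : Set α}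
    (hFtop : ⊤ ∈ F) (hFinf : ∀ a ∈ F, ∀ b ∈ F, a ⊓ b ∈ F) (hFup : ∀ a b, a ≤ b → a ∈ F → b ∈ F)
    (hIbot : ⊥ ∈ I) (hIsup : ∀ a ∈ I, ∀ b ∈ I, a ⊔ b ∈ I) (hIdown : ∀ a b, a ≤ b → b ∈ I → a ∈ I)
    (hFI : ∀ a ∈ F, a ∉ I) :
    ∃ J : Ideal α, J.IsPrime ∧ (∀ a ∈ I, a ∈ J) ∧ ∀ a ∈ F, a ∉ J := by
  have hF : IsPFilter F := IsPFilter.of_def ⟨⊤, hFtop⟩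
    (fun a ha b hb => ⟨a ⊓ b, hFinf a ha b hb, inf_le_left, inf_le_right⟩)
    (fun {a b} hab ha => hFup a b hab ha)
  let I' : Ideal α :=
    { carrier := I
      lower' := fun a b hba ha => hIdown b a hba ha
      nonempty' := ⟨⊥, hIbot⟩
      directed' := fun a ha b hb => ⟨a ⊔ b, hIsup a ha b hb, le_sup_left, le_sup_right⟩ }
  have hdisj : Disjoint (hF.toPFilter : Set α) (I' : Set α) :=
    Set.disjoint_left.2 fun a ha hb => hFI a ha hb
  obtain ⟨J, hJ, hIJ, hFJ⟩ := DistribLattice.prime_ideal_of_disjoint_filter_ideal hdisj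
  exact ⟨J, hJ, fun a ha => hIJ ha, fun a ha hb => Set.disjoint_left.1 hFJ ha hb⟩

variable {α : Type*} [BiheytingAlgebra α] {J : Ideal α}

theorem Order.Ideal.IsPrime.top_notMem' (hJ : J.IsPrime) : ⊤ ∉ J :=
  fun h => hJ.ne_univ (Set.eq_univ_of_forall fun a => J.lower (le_top (a := a)) h)

theorem Order.Ideal.IsPrime.inf_mem_iff (hJ : J.IsPrime) {a b : α} :
    a ⊓ b ∈ J ↔ a ∈ J ∨ b ∈ J :=
  ⟨hJ.mem_or_mem, fun h => h.elim (J.lower inf_le_left) (J.lower inf_le_right)⟩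

/-- By residuation, `{c | a ⇨ c ∉ J}` is the filter generated by `a` and the complement of `J`; it
avoids `b`, so a prime ideal separates the two. The result is the successor theory that refutes an
implication. -/
theorem Order.Ideal.IsPrime.exists_of_himp_mem (hJ : J.IsPrime) {a b : α} (h : a ⇨ b ∈ J) :
    ∃ J' : Ideal α, J'.IsPrime ∧ (∀ c ∈ J', c ∈ J) ∧ a ∉ J' ∧ b ∈ J' := by
  obtain ⟨J', hJ', hI, hF⟩ := exists_isPrime_of_separated (F := {c | a ⇨ c ∉ J}) (I := Set.Iic b)
    (by simpa using hJ.top_notMem')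
    (fun c hc d hd => by
      simp only [Set.mem_ofPred_eq, himp_inf_distrib, hJ.inf_mem_iff, not_or] at *
      exact ⟨hc, hd⟩)
    (fun c d hcd hc hd => hc (J.lower (himp_le_himp_left hcd) hd))
    bot_le (fun c hc d hd => sup_le hc hd) (fun c d hcd hd => le_trans hcd hd)
    (fun c hc hcb => hc (J.lower (himp_le_himp_left hcb) h))
  refine ⟨J', hJ', fun c hc => ?_, hF a (by simpa using hJ.top_notMem'), hI b le_rfl⟩
  by_contra hcJ
  exact hF c (fun h' => hcJ (J.lower le_himp h')) hc

/-- Dually, `{c | c \ b ∈ J}` is the ideal generated by `J` and `b`, and it omits `a`. -/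
theorem Order.Ideal.IsPrime.exists_of_sdiff_notMem {a b : α} (h : a \ b ∉ J) :
    ∃ J' : Ideal α, J'.IsPrime ∧ (∀ c ∈ J, c ∈ J') ∧ a ∉ J' ∧ b ∈ J' := by
  obtain ⟨J', hJ', hI, hF⟩ := exists_isPrime_of_separated (I := {c | c \ b ∈ J}) (F := Set.Ici a)
    le_top (fun c hc d hd => le_inf hc hd) (fun c d hcd hc => le_trans hc hcd)
    (by simp)
    (fun c hc d hd => by
      simp only [Set.mem_ofPred_eq, sup_sdiff] at *
      exact J.sup_mem hc hd)
    (fun c d hcd hd => J.lower (sdiff_le_sdiff_right hcd) hd)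
    (fun c hc hcb => h (J.lower (sdiff_le_sdiff_right hc) hcb))
  exact ⟨J', hJ', fun c hc => hI c (J.lower sdiff_le hc), hF a le_rfl, hI b (by simp)⟩

/-- A lower adjoint preserves finite joins, so the preimage of `J` under `l` is an ideal; it omits
`a`. This yields the predecessor witnessing `◆`. -/
theorem Order.Ideal.IsPrime.exists_of_lowerAdjoint_notMem {l u : α → α}
    (gc : GaloisConnection l u) {a : α} (h : l a ∉ J) :
    ∃ J' : Ideal α, J'.IsPrime ∧ a ∉ J' ∧ ∀ c, l c ∈ J → c ∈ J' := by
  obtain ⟨J', hJ', hI, hF⟩ := exists_isPrime_of_separated (I := {c | l c ∈ J}) (F := Set.Ici a)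
    le_top (fun c hc d hd => le_inf hc hd) (fun c d hcd hc => le_trans hc hcd)
    (by simp [gc.l_bot])
    (fun c hc d hd => by
      simp only [Set.mem_ofPred_eq, gc.l_sup] at *
      exact J.sup_mem hc hd)
    (fun c d hcd hd => J.lower (gc.monotone_l hcd) hd)
    (fun c hc hcb => h (J.lower (gc.monotone_l hc) hcb))
  exact ⟨J', hJ', hF a le_rfl, hI⟩

/-- An upper adjoint preserves finite meets and `J` is prime, so `{c | u c ∉ J}` is a filter. This
yields the successor refuting `□`. -/
theorem Order.Ideal.IsPrime.exists_of_upperAdjoint_mem (hJ : J.IsPrime) {l u : α → α}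
    (gc : GaloisConnection l u) {a : α} (h : u a ∈ J) :
    ∃ J' : Ideal α, J'.IsPrime ∧ a ∈ J' ∧ ∀ c ∈ J', u c ∈ J := by
  obtain ⟨J', hJ', hI, hF⟩ := exists_isPrime_of_separated (F := {c | u c ∉ J}) (I := Set.Iic a)
    (by simpa [gc.u_top] using hJ.top_notMem')
    (fun c hc d hd => by
      simp only [Set.mem_ofPred_eq, gc.u_inf, hJ.inf_mem_iff, not_or] at *
      exact ⟨hc, hd⟩)
    (fun c d hcd hc hd => hc (J.lower (gc.monotone_u hcd) hd))
    bot_le (fun c hc d hd => sup_le hc hd) (fun c d hcd hd => le_trans hcd hd)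
    (fun c hc hcb => hc (J.lower (gc.monotone_u hcb) h))
  exact ⟨J', hJ', hI a le_rfl, fun c hc => by_contra fun h' => hF c h' hc⟩

end PrimeIdeals

/-! ### The Lindenbaum algebra of a `bist`-logic -/

/-- The substitution that replaces the first two variables by `a` and `b`, all others by `c`. -/
def Form.inst (a b c : Form) : ℕ → Form
  | 0 => a
  | 1 => b
  | _ => c

namespace IsBistLogic

open Form

variable {L : Set Form}

/-- Provable implication. -/
def Le (_ : IsBistLogic L) (a b : Form) : Prop := imp a b ∈ L

variable (h : IsBistLogic L) {a b c d : Form}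

theorem imp_self_of_mem (hb : b ∈ L) : h.Le a b :=
  h.mp _ _ hb (h.us _ (inst b a b) (h.ax _ .a0))

theorem Le.mp (hab : h.Le a (imp b c)) (hb : h.Le a b) : h.Le a c :=
  h.mp _ _ hb (h.mp _ _ hab (h.us _ (inst a b c) (h.ax _ .a1)))

theorem le_refl (a : Form) : h.Le a a :=
  -- The combinator identity `I = S K K`.
  Le.mp h (h.us _ (inst a (imp a a) a) (h.ax _ .a0)) (h.us _ (inst a a a) (h.ax _ .a0))

variable {h}

theorem Le.trans (hab : h.Le a b) (hbc : h.Le b c) : h.Le a c :=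
  Le.mp h (h.imp_self_of_mem hbc) hab

variable (h)

theorem and_le_left (a b : Form) : h.Le (and a b) a := h.us _ (inst a b a) (h.ax _ .a5)

theorem and_le_right (a b : Form) : h.Le (and a b) b := h.us _ (inst a b a) (h.ax _ .a6)

theorem le_or_left (a b : Form) : h.Le a (or a b) := h.us _ (inst a b a) (h.ax _ .a2)

theorem le_or_right (a b : Form) : h.Le b (or a b) := h.us _ (inst a b a) (h.ax _ .a3)

theorem bot_le (a : Form) : h.Le bot a := h.us _ (inst a a a) (h.ax _ .a8)

theorem le_top (a : Form) : h.Le a top := h.us _ (inst a a a) (h.ax _ .a9)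

theorem le_imp_and (a b : Form) : h.Le a (imp b (and a b)) := h.us _ (inst a b a) (h.ax _ .a7)

variable {h}

theorem le_and (hb : h.Le a b) (hc : h.Le a c) : h.Le a (and b c) :=
  Le.mp h (hb.trans (h.le_imp_and b c)) hc

theorem or_le (ha : h.Le a c) (hb : h.Le b c) : h.Le (or a b) c :=
  h.mp _ _ hb (h.mp _ _ ha (h.us _ (inst a b c) (h.ax _ .a4)))

theorem le_imp_iff : h.Le a (imp b c) ↔ h.Le (and a b) c := by
  refine ⟨fun H => Le.mp h ((h.and_le_left a b).trans H) (h.and_le_right a b), fun H => ?_⟩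
  have h1 : h.Le (imp b (and a b)) (imp b c) :=
    h.mp _ _ (h.imp_self_of_mem H) (h.us _ (inst b (and a b) c) (h.ax _ .a1))
  exact (h.le_imp_and a b).trans h1

/-- Axioms `a10` and `a11` are the unit and counit of this residuation; `a12` and `a13` play the
same role for `◆ ⊣ □` below. -/
theorem coimp_le_iff : h.Le (coimp a b) c ↔ h.Le a (or b c) := by
  refine ⟨fun H => ?_, fun H => ?_⟩
  · have h1 : h.Le a (or b (coimp a b)) := h.us _ (inst a b a) (h.ax _ .a10)
    exact h1.trans (or_le (h.le_or_left b c) (H.trans (h.le_or_right b c)))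
  · have h1 : h.Le (coimp (or b c) b) c := h.us _ (inst a b c) (h.ax _ .a11)
    exact Le.trans (h.monCoimp _ _ b H) h1

theorem bdia_le_iff : h.Le (bdia a) b ↔ h.Le a (box b) := by
  refine ⟨fun H => ?_, fun H => ?_⟩
  · have h1 : h.Le a (box (bdia a)) := h.us _ (inst a a a) (h.ax _ .a12)
    exact h1.trans (h.monBox _ _ H)
  · have h1 : h.Le (bdia (box b)) b := h.us _ (inst b b b) (h.ax _ .a13)
    exact Le.trans (h.monBdia _ _ H) h1

theorem and_mono (hab : h.Le a b) (hcd : h.Le c d) : h.Le (and a c) (and b d) :=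
  le_and ((h.and_le_left a c).trans hab) ((h.and_le_right a c).trans hcd)

theorem or_mono (hab : h.Le a b) (hcd : h.Le c d) : h.Le (or a c) (or b d) :=
  or_le (hab.trans (h.le_or_left b d)) (hcd.trans (h.le_or_right b d))

theorem imp_mono (hba : h.Le b a) (hcd : h.Le c d) : h.Le (imp a c) (imp b d) :=
  le_imp_iff.2 (((and_mono (h.le_refl _) hba).trans (le_imp_iff.1 (h.le_refl _))).trans hcd)

/-- The monotonicity rule covers only the first argument; residuation gives antitonicity in the
second. -/
theorem coimp_mono (hab : h.Le a b) (hdc : h.Le d c) : h.Le (coimp a c) (coimp b d) :=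
  coimp_le_iff.2 (hab.trans ((coimp_le_iff.1 (h.le_refl _)).trans (or_mono hdc (h.le_refl _))))

variable (h)

/-- Provable equivalence. -/
def setoid : Setoid Form where
  r a b := h.Le a b ∧ h.Le b a
  iseqv :=
    { refl := fun a => ⟨h.le_refl a, h.le_refl a⟩
      symm := fun H => ⟨H.2, H.1⟩
      trans := fun H H' => ⟨H.1.trans H'.1, H'.2.trans H.2⟩ }

/-- The algebra of formulas modulo provable equivalence. -/
def Lindenbaum : Type := Quotient h.setoid

/-- The class of a formula in the Lindenbaum algebra. -/
def cls (a : Form) : h.Lindenbaum := Quotient.mk h.setoid a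

namespace Lindenbaum

instance : BiheytingAlgebra h.Lindenbaum where
  le := Quotient.lift₂ h.Le fun _ _ _ _ H H' =>
    propext ⟨fun h1 => (H.2.trans h1).trans H'.1, fun h1 => (H.1.trans h1).trans H'.2⟩
  le_refl := by rintro ⟨a⟩; exact h.le_refl a
  le_trans := by rintro ⟨a⟩ ⟨b⟩ ⟨c⟩ h1 h2; exact Le.trans h1 h2
  le_antisymm := by rintro ⟨a⟩ ⟨b⟩ h1 h2; exact Quotient.sound ⟨h1, h2⟩
  inf := Quotient.map₂ and fun _ _ H _ _ H' => ⟨and_mono H.1 H'.1, and_mono H.2 H'.2⟩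
  inf_le_left := by rintro ⟨a⟩ ⟨b⟩; exact h.and_le_left a b
  inf_le_right := by rintro ⟨a⟩ ⟨b⟩; exact h.and_le_right a b
  le_inf := by rintro ⟨a⟩ ⟨b⟩ ⟨c⟩ h1 h2; exact le_and h1 h2
  sup := Quotient.map₂ or fun _ _ H _ _ H' => ⟨or_mono H.1 H'.1, or_mono H.2 H'.2⟩
  le_sup_left := by rintro ⟨a⟩ ⟨b⟩; exact h.le_or_left a b
  le_sup_right := by rintro ⟨a⟩ ⟨b⟩; exact h.le_or_right a b
  sup_le := by rintro ⟨a⟩ ⟨b⟩ ⟨c⟩ h1 h2; exact or_le h1 h2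
  top := h.cls top
  le_top := by rintro ⟨a⟩; exact h.le_top a
  bot := h.cls bot
  bot_le := by rintro ⟨a⟩; exact h.bot_le a
  himp := Quotient.map₂ imp fun _ _ H _ _ H' => ⟨imp_mono H.2 H'.1, imp_mono H.1 H'.2⟩
  le_himp_iff := by rintro ⟨a⟩ ⟨b⟩ ⟨c⟩; exact le_imp_iff
  compl := Quotient.map (fun a => imp a bot) fun _ _ H =>
    ⟨imp_mono H.2 (h.le_refl _), imp_mono H.1 (h.le_refl _)⟩
  himp_bot := by rintro ⟨a⟩; rfl
  sdiff := Quotient.map₂ coimp fun _ _ H _ _ H' => ⟨coimp_mono H.1 H'.2, coimp_mono H.2 H'.1⟩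
  sdiff_le_iff := by rintro ⟨a⟩ ⟨b⟩ ⟨c⟩; exact coimp_le_iff
  hnot := Quotient.map (coimp top) fun _ _ H =>
    ⟨coimp_mono (h.le_refl _) H.2, coimp_mono (h.le_refl _) H.1⟩
  top_sdiff := by rintro ⟨a⟩; rfl

/-- The operation `◆` on the Lindenbaum algebra. -/
def dia : h.Lindenbaum → h.Lindenbaum :=
  Quotient.map bdia fun _ _ H => ⟨h.monBdia _ _ H.1, h.monBdia _ _ H.2⟩

/-- The operation `□` on the Lindenbaum algebra. -/
def nec : h.Lindenbaum → h.Lindenbaum :=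
  Quotient.map box fun _ _ H => ⟨h.monBox _ _ H.1, h.monBox _ _ H.2⟩

theorem gc_dia_nec : GaloisConnection (dia h) (nec h) := by
  rintro ⟨a⟩ ⟨b⟩
  exact bdia_le_iff (h := h)

end Lindenbaum

open Lindenbaum

theorem cls_top : h.cls top = ⊤ := rfl
theorem cls_bot : h.cls bot = ⊥ := rfl
theorem cls_and (a b : Form) : h.cls (and a b) = h.cls a ⊓ h.cls b := rfl
theorem cls_or (a b : Form) : h.cls (or a b) = h.cls a ⊔ h.cls b := rfl
theorem cls_imp (a b : Form) : h.cls (imp a b) = h.cls a ⇨ h.cls b := rfl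
theorem cls_coimp (a b : Form) : h.cls (coimp a b) = h.cls a \ h.cls b := rfl
theorem cls_bdia (a : Form) : h.cls (bdia a) = dia h (h.cls a) := rfl
theorem cls_box (a : Form) : h.cls (box a) = nec h (h.cls a) := rfl

theorem cls_eq_top_iff : h.cls a = ⊤ ↔ a ∈ L := by
  rw [eq_top_iff]
  refine ⟨fun H => ?_, fun H => h.imp_self_of_mem H⟩
  -- `⊤` is not itself an axiom; it follows from any theorem by `p → ⊤`.
  have ht : top ∈ L := h.mp _ _ (h.le_refl top) (h.le_top (imp top top))
  exact h.mp _ _ ht H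

theorem dia_dia_le {p : ℕ} (ht : transForm p ∈ L) (x : h.Lindenbaum) :
    dia h (dia h x) ≤ dia h x := by
  obtain ⟨a⟩ := x
  exact h.us _ (fun _ => a) ht

/-- Transposing twice along `◆ ⊣ □` reduces this to `◆◆□x ≤ x`. -/
theorem nec_le_nec_nec {p : ℕ} (ht : transForm p ∈ L) (x : h.Lindenbaum) :
    nec h x ≤ nec h (nec h x) := by
  rw [← (gc_dia_nec h).le_iff_le, ← (gc_dia_nec h).le_iff_le]
  exact (h.dia_dia_le ht _).trans ((gc_dia_nec h).l_u_le x)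

theorem le_dia {p : ℕ} (hr : reflForm p ∈ L) (x : h.Lindenbaum) : x ≤ dia h x := by
  obtain ⟨a⟩ := x
  exact h.us _ (fun _ => a) hr

/-- Every nontheorem is omitted by some prime theory, given as the complement of a prime ideal. -/
theorem exists_isPrime_cls_mem (ha : a ∉ L) :
    ∃ J : Order.Ideal h.Lindenbaum, J.IsPrime ∧ h.cls a ∈ J := by
  obtain ⟨J, hJ, hI, -⟩ := exists_isPrime_of_separated (F := {⊤}) (I := Set.Iic (h.cls a))
    rfl (by simp) (by rintro _ b hb rfl; exact top_le_iff.1 hb)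
    (Set.mem_Iic.2 _root_.bot_le) (fun c hc d hd => Set.mem_Iic.2 (sup_le hc hd))
    (fun c d hcd hd => Set.mem_Iic.2 (_root_.le_trans hcd hd))
    (by rintro _ rfl H; exact ha (h.cls_eq_top_iff.1 (top_le_iff.1 H)))
  exact ⟨J, hJ, hI _ Set.self_mem_Iic⟩

end IsBistLogic

/-! ### Finite models coded by natural numbers -/

namespace ModelCode

/-- `i` belongs to the finite set of numbers with binary code `X`. -/
def Mem (X i : ℕ) : Prop := X.testBit i = true

/-- Inclusion of coded sets, below `m`. -/
def Incl (m X Y : ℕ) : Prop := ∀ i < m, Mem X i → Mem Y i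

/-- The accessibility relation between sets of codes of formulas, for formulas with codes below
`m`. It is transitive and stable by definition. -/
def Acc (m X Y : ℕ) : Prop :=
  ∀ k < m, (7 * k + 7 < m → Mem X k ∨ Mem X (7 * k + 7) → Mem Y (7 * k + 7)) ∧
    (7 * k + 8 < m → Mem X (7 * k + 8) → Mem Y k ∧ Mem Y (7 * k + 8))

/-- The coded set `X` obeys the truth conditions in the family `W` for the constants and for all
formulas with code below `m` whose immediate subformulas have the codes `a`, `b`. -/
def Coherent (m W X a b : ℕ) : Prop :=
  (0 < m → Mem X 0) ∧ (1 < m → ¬ Mem X 1) ∧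
  (7 * Nat.pair a b + 3 < m → (Mem X (7 * Nat.pair a b + 3) ↔ Mem X a ∧ Mem X b)) ∧
  (7 * Nat.pair a b + 4 < m → (Mem X (7 * Nat.pair a b + 4) ↔ Mem X a ∨ Mem X b)) ∧
  (7 * Nat.pair a b + 5 < m → (Mem X (7 * Nat.pair a b + 5) ↔
    ∀ Y < 2 ^ m, Mem W Y → Incl m X Y → Mem Y a → Mem Y b)) ∧
  (7 * Nat.pair a b + 6 < m → (Mem X (7 * Nat.pair a b + 6) ↔
    ∃ Y < 2 ^ m, Mem W Y ∧ Incl m Y X ∧ Mem Y a ∧ ¬ Mem Y b)) ∧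
  (7 * a + 7 < m → (Mem X (7 * a + 7) ↔ ∃ Y < 2 ^ m, Mem W Y ∧ Acc m Y X ∧ Mem Y a)) ∧
  (7 * a + 8 < m → (Mem X (7 * a + 8) ↔ ∀ Y < 2 ^ m, Mem W Y → Acc m X Y → Mem Y a))

/-- `W` codes a finite model, reflexive if `r` holds, for the formulas with codes below `m`. -/
def IsModel (r : Bool) (m W : ℕ) : Prop :=
  ∀ X < 2 ^ m, Mem W X → (r = true → Acc m X X) ∧ ∀ a < m, ∀ b < m, Coherent m W X a b

/-- `W` codes a finite model that refutes the formula with code `n`. -/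
def Refutes (r : Bool) (n W : ℕ) : Prop :=
  IsModel r (n + 1) W ∧ ∃ X < 2 ^ (n + 1), Mem W X ∧ ¬ Mem X n

/-- Both clauses pass on the modal formula itself, `◆α` or `□α`, so they can be chained. -/
theorem Acc.trans {m X Y Z : ℕ} (h1 : Acc m X Y) (h2 : Acc m Y Z) : Acc m X Z := fun k hk =>
  ⟨fun hm h => ((h2 k hk).1 hm (Or.inr ((h1 k hk).1 hm h))),
    fun hm h => ((h2 k hk).2 hm ((h1 k hk).2 hm h).2)⟩

/-- The finite frame coded by `W`. -/
def frame (m W X₀ : ℕ) (hX₀ : X₀ < 2 ^ m ∧ Mem W X₀) : HFrame where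
  U := {X : ℕ // X < 2 ^ m ∧ Mem W X}
  nonempty := ⟨⟨X₀, hX₀⟩⟩
  H X Y := Incl m X Y
  R X Y := Acc m X Y
  refl _ _ _ h := h
  trans _ _ _ h1 h2 i hi h := h2 i hi (h1 i hi h)
  stable _ _ _ _ h1 h2 h3 k hk :=
    ⟨fun hm h => h3 _ hm ((h2 k hk).1 hm (h.imp (h1 _ hk) (h1 _ hm))),
      fun hm h => ((h2 k hk).2 hm (h1 _ hm h)).imp (h3 _ hk) (h3 _ hm)⟩

/-- Truth lemma: subformulas have smaller codes, so induction stays below `m` and each case is one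
clause of `Coherent`. The guard `7 * p + 2 < m` makes the valuation visibly upward closed, as `Incl
m` speaks only of indices below `m`. -/
theorem sat_frame_iff {r : Bool} {m W X₀ : ℕ} {hX₀ : X₀ < 2 ^ m ∧ Mem W X₀}
    (hW : IsModel r m W) (φ : Form) (hφ : φ.toNat < m) (X : (frame m W X₀ hX₀).U) :
    (frame m W X₀ hX₀).Sat (fun p => {Y | 7 * p + 2 < m ∧ Mem Y.1 (7 * p + 2)}) φ X ↔
      Mem X.1 φ.toNat := by
  have key : ∀ Y : (frame m W X₀ hX₀).U, ∀ a < m, ∀ b < m, Coherent m W Y.1 a b :=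
    fun Y => (hW Y.1 Y.2.1 Y.2.2).2
  induction φ generalizing X with
  | top => exact iff_of_true trivial ((key X 0 hφ 0 hφ).1 hφ)
  | bot =>
    exact iff_of_false id ((key X 0 (Nat.zero_lt_of_lt hφ) 0 (Nat.zero_lt_of_lt hφ)).2.1 hφ)
  | var n => exact ⟨fun h => h.2, fun h => ⟨hφ, h⟩⟩
  | and φ ψ ih1 ih2 =>
    have ha := Nat.left_le_pair φ.toNat ψ.toNat
    have hb := Nat.right_le_pair φ.toNat ψ.toNat
    simp only [Form.toNat] at hφ ⊢
    have ha' : φ.toNat < m := by omega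
    have hb' : ψ.toNat < m := by omega
    simp only [HFrame.Sat, ih1 ha', ih2 hb']
    exact ((key X _ ha' _ hb').2.2.1 hφ).symm
  | or φ ψ ih1 ih2 =>
    have ha := Nat.left_le_pair φ.toNat ψ.toNat
    have hb := Nat.right_le_pair φ.toNat ψ.toNat
    simp only [Form.toNat] at hφ ⊢
    have ha' : φ.toNat < m := by omega
    have hb' : ψ.toNat < m := by omega
    simp only [HFrame.Sat, ih1 ha', ih2 hb']
    exact ((key X _ ha' _ hb').2.2.2.1 hφ).symm
  | imp φ ψ ih1 ih2 =>
    have ha := Nat.left_le_pair φ.toNat ψ.toNat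
    have hb := Nat.right_le_pair φ.toNat ψ.toNat
    simp only [Form.toNat] at hφ ⊢
    have ha' : φ.toNat < m := by omega
    have hb' : ψ.toNat < m := by omega
    simp only [HFrame.Sat, ih1 ha', ih2 hb', (key X _ ha' _ hb').2.2.2.2.1 hφ]
    exact ⟨fun h Y h1 h2 => h ⟨Y, h1, h2⟩, fun h Y => h Y.1 Y.2.1 Y.2.2⟩
  | coimp φ ψ ih1 ih2 =>
    have ha := Nat.left_le_pair φ.toNat ψ.toNat
    have hb := Nat.right_le_pair φ.toNat ψ.toNat
    simp only [Form.toNat] at hφ ⊢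
    have ha' : φ.toNat < m := by omega
    have hb' : ψ.toNat < m := by omega
    simp only [HFrame.Sat, ih1 ha', ih2 hb', (key X _ ha' _ hb').2.2.2.2.2.1 hφ]
    exact ⟨fun ⟨Y, h⟩ => ⟨Y.1, Y.2.1, Y.2.2, h⟩, fun ⟨Y, h1, h2, h⟩ => ⟨⟨Y, h1, h2⟩, h⟩⟩
  | bdia φ ih =>
    simp only [Form.toNat] at hφ ⊢
    have ha' : φ.toNat < m := by omega
    simp only [HFrame.Sat, ih ha', (key X _ ha' _ ha').2.2.2.2.2.2.1 hφ]
    exact ⟨fun ⟨Y, h⟩ => ⟨Y.1, Y.2.1, Y.2.2, h⟩, fun ⟨Y, h1, h2, h⟩ => ⟨⟨Y, h1, h2⟩, h⟩⟩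
  | box φ ih =>
    simp only [Form.toNat] at hφ ⊢
    have ha' : φ.toNat < m := by omega
    simp only [HFrame.Sat, ih ha', (key X _ ha' _ ha').2.2.2.2.2.2.2 hφ]
    exact ⟨fun h Y h1 h2 => h ⟨Y, h1, h2⟩, fun h Y => h Y.1 Y.2.1 Y.2.2⟩

/-- A refuting code yields a finite transitive frame that refutes the formula. -/
theorem Refutes.exists_frame {r : Bool} {φ : Form} {W : ℕ} (h : Refutes r φ.toNat W) :
    ∃ F : HFrame, Finite F.U ∧ (∀ u v w, F.R u v → F.R v w → F.R u w) ∧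
      (r = true → ∀ u, F.R u u) ∧ ¬ F.Valid φ := by
  obtain ⟨hW, X, hX, hXW, hXn⟩ := h
  refine ⟨frame _ W X ⟨hX, hXW⟩, ?_, fun _ _ _ => Acc.trans,
    fun hr Y => (hW Y.1 Y.2.1 Y.2.2).1 hr, fun hv => hXn ?_⟩
  · exact Set.Finite.to_subtype ((Set.finite_lt_nat (2 ^ (φ.toNat + 1))).subset fun Y hY => hY.1)
  · refine (sat_frame_iff (hX₀ := ⟨hX, hXW⟩) hW φ (Nat.lt_succ_self _) ⟨X, hX, hXW⟩).1
      (hv _ (fun p u v huv hu => ?_) _)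
    exact ⟨hu.1, huv _ hu.1 hu.2⟩

end ModelCode

/-! ### Soundness -/

namespace HFrame

/-- Stability is what makes `◆` and `□` persistent. Persistence is needed for soundness of
substitution, where truth sets serve as valuations. -/
theorem isHSet_sat (F : HFrame) {V : ℕ → Set F.U} (hV : ∀ p, F.IsHSet (V p)) (φ : Form) :
    F.IsHSet {u | F.Sat V φ u} := by
  intro u v huv
  induction φ generalizing u v with
  | top => exact id
  | bot => exact id
  | var p => exact hV p u v huv
  | and φ ψ ih1 ih2 => exact And.imp (ih1 u v huv) (ih2 u v huv)
  | or φ ψ ih1 ih2 => exact Or.imp (ih1 u v huv) (ih2 u v huv)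
  | imp φ ψ => exact fun h w hw => h w (F.trans _ _ _ huv hw)
  | coimp φ ψ => exact fun ⟨w, hw, h⟩ => ⟨w, F.trans _ _ _ hw huv, h⟩
  | bdia φ => exact fun ⟨w, hw, h⟩ => ⟨w, F.stable _ _ _ _ (F.refl w) hw huv, h⟩
  | box φ => exact fun h w hw => h w (F.stable _ _ _ _ huv hw (F.refl w))

theorem sat_subst_iff (F : HFrame) (V : ℕ → Set F.U) (σ : ℕ → Form) (φ : Form) (u : F.U) :
    F.Sat V (φ.subst σ) u ↔ F.Sat (fun p => {v | F.Sat V (σ p) v}) φ u := by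
  induction φ generalizing u with
  | top => rfl
  | bot => rfl
  | var p => rfl
  | and φ ψ ih1 ih2 => simp only [Form.subst, Sat, ih1, ih2]
  | or φ ψ ih1 ih2 => simp only [Form.subst, Sat, ih1, ih2]
  | imp φ ψ ih1 ih2 => simp only [Form.subst, Sat, ih1, ih2]
  | coimp φ ψ ih1 ih2 => simp only [Form.subst, Sat, ih1, ih2]
  | bdia φ ih => simp only [Form.subst, Sat, ih]
  | box φ ih => simp only [Form.subst, Sat, ih]

theorem isBistLogic_valid (F : HFrame) : IsBistLogic {φ | F.Valid φ} where
  ax φ hφ V hV u := by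
    have up : ∀ p u v, F.H u v → u ∈ V p → v ∈ V p := hV
    have rf := F.refl
    have tr := F.trans
    cases hφ with
    | a0 => exact fun v _ hv w hw _ => up _ _ _ hw hv
    | a1 => exact fun v _ h1 w hw h2 x hx h3 => h1 x (tr _ _ _ hw hx) h3 x (rf x) (h2 x hx h3)
    | a2 => exact fun v _ h => Or.inl h
    | a3 => exact fun v _ h => Or.inr h
    | a4 =>
      exact fun v _ h1 w hw h2 x hx h3 =>
        h3.elim (h1 x (tr _ _ _ hw hx)) (h2 x hx)
    | a5 => exact fun v _ h => h.1
    | a6 => exact fun v _ h => h.2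
    | a7 => exact fun v _ h w hw h' => ⟨up _ _ _ hw h, h'⟩
    | a8 => exact fun v _ h => h.elim
    | a9 => exact fun v _ _ => trivial
    | a10 => exact fun v _ h => or_iff_not_imp_left.2 fun h' => ⟨v, rf v, h, h'⟩
    | a11 => exact fun v _ ⟨w, hw, h1, h2⟩ => up _ _ _ hw (h1.resolve_left h2)
    | a12 => exact fun v _ h w hw => ⟨v, hw, h⟩
    | a13 => exact fun v _ ⟨w, hw, h⟩ => h v hw
  mp φ ψ h1 h2 V hV u := h2 V hV u u (F.refl u) (h1 V hV u)
  us φ σ h V hV u :=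
    (F.sat_subst_iff V σ φ u).2 (h _ (fun p => F.isHSet_sat hV (σ p)) u)
  monCoimp δ₁ δ₂ ψ h V hV u := fun v _ ⟨w, hw, h1, h2⟩ => ⟨w, hw, h V hV w w (F.refl w) h1, h2⟩
  monBox φ ψ h V hV u := fun v _ h1 w hw => h V hV w w (F.refl w) (h1 w hw)
  monBdia φ ψ h V hV u := fun v _ ⟨w, hw, h1⟩ => ⟨w, hw, h V hV w w (F.refl w) h1⟩

theorem valid_transForm (F : HFrame) (h : ∀ u v w, F.R u v → F.R v w → F.R u w) (p : ℕ) :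
    F.Valid (transForm p) :=
  fun _ _ _ _ _ ⟨_, hw, x, hx, h1⟩ => ⟨x, h _ _ _ hx hw, h1⟩

theorem valid_reflForm (F : HFrame) (h : ∀ u, F.R u u) (p : ℕ) : F.Valid (reflForm p) :=
  fun _ _ _ v _ hv => ⟨v, h v, hv⟩

end HFrame

/-! ### Completeness -/

namespace Form

/-- The decoding equations are read off from the bijection, without unfolding the well-founded
recursion. -/
theorem ofNat_and (a b : ℕ) : ofNat (7 * Nat.pair a b + 3) = and (ofNat a) (ofNat b) := by
  simpa [toNat, toNat_ofNat] using ofNat_toNat (and (ofNat a) (ofNat b))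

theorem ofNat_or (a b : ℕ) : ofNat (7 * Nat.pair a b + 4) = or (ofNat a) (ofNat b) := by
  simpa [toNat, toNat_ofNat] using ofNat_toNat (or (ofNat a) (ofNat b))

theorem ofNat_imp (a b : ℕ) : ofNat (7 * Nat.pair a b + 5) = imp (ofNat a) (ofNat b) := by
  simpa [toNat, toNat_ofNat] using ofNat_toNat (imp (ofNat a) (ofNat b))

theorem ofNat_coimp (a b : ℕ) : ofNat (7 * Nat.pair a b + 6) = coimp (ofNat a) (ofNat b) := by
  simpa [toNat, toNat_ofNat] using ofNat_toNat (coimp (ofNat a) (ofNat b))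

theorem ofNat_bdia (a : ℕ) : ofNat (7 * a + 7) = bdia (ofNat a) := by
  simpa [toNat, toNat_ofNat] using ofNat_toNat (bdia (ofNat a))

theorem ofNat_box (a : ℕ) : ofNat (7 * a + 8) = box (ofNat a) := by
  simpa [toNat, toNat_ofNat] using ofNat_toNat (box (ofNat a))

end Form

namespace IsBistLogic

open ModelCode Order Lindenbaum

variable {L : Set Form} (h : IsBistLogic L) (m : ℕ)

open Classical in
/-- The code of the set of formulas with code below `m` whose class is outside `J`. -/
noncomputable def trace (J : Ideal h.Lindenbaum) : ℕ :=
  Nat.ofBits fun i : Fin m => decide (h.cls (Form.ofNat i) ∉ J)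

open Classical in
/-- The code of the set of all traces of prime theories. -/
noncomputable def traces : ℕ :=
  Nat.ofBits fun X : Fin (2 ^ m) => decide (∃ J : Ideal h.Lindenbaum, J.IsPrime ∧ h.trace m J = X)

theorem trace_lt (J : Ideal h.Lindenbaum) : h.trace m J < 2 ^ m := Nat.ofBits_lt_two_pow _

variable {m}

theorem mem_trace_iff {J : Ideal h.Lindenbaum} {i : ℕ} (hi : i < m) :
    Mem (h.trace m J) i ↔ h.cls (Form.ofNat i) ∉ J := by
  simp [Mem, trace, hi]

theorem mem_traces_iff {X : ℕ} (hX : X < 2 ^ m) :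
    Mem (h.traces m) X ↔ ∃ J : Ideal h.Lindenbaum, J.IsPrime ∧ h.trace m J = X := by
  simp [Mem, traces, hX]

theorem mem_traces {J : Ideal h.Lindenbaum} (hJ : J.IsPrime) :
    Mem (h.traces m) (h.trace m J) :=
  (h.mem_traces_iff (h.trace_lt m J)).2 ⟨J, hJ, rfl⟩

/-- Truth conditions over coded sets can thus be checked over prime ideals. -/
theorem forall_mem_traces {P : ℕ → Prop} :
    (∀ Y < 2 ^ m, Mem (h.traces m) Y → P Y) ↔
      ∀ J : Ideal h.Lindenbaum, J.IsPrime → P (h.trace m J) := by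
  refine ⟨fun H J hJ => H _ (h.trace_lt m J) (h.mem_traces hJ), fun H Y hY hW => ?_⟩
  obtain ⟨J, hJ, rfl⟩ := (h.mem_traces_iff hY).1 hW
  exact H J hJ

theorem exists_mem_traces {P : ℕ → Prop} :
    (∃ Y < 2 ^ m, Mem (h.traces m) Y ∧ P Y) ↔
      ∃ J : Ideal h.Lindenbaum, J.IsPrime ∧ P (h.trace m J) := by
  constructor
  · rintro ⟨Y, hY, hW, hP⟩
    obtain ⟨J, hJ, rfl⟩ := (h.mem_traces_iff hY).1 hW
    exact ⟨J, hJ, hP⟩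
  · rintro ⟨J, hJ, hP⟩
    exact ⟨_, h.trace_lt m J, h.mem_traces hJ, hP⟩

theorem incl_trace {J K : Ideal h.Lindenbaum} (hJK : ∀ c ∈ K, c ∈ J) :
    Incl m (h.trace m J) (h.trace m K) := fun i hi H => by
  rw [h.mem_trace_iff hi] at *
  exact fun H' => H (hJK _ H')

/-- The hypothesis is the canonical relation: whatever holds at `J` has its `◆` at `K`. The `◆α` and
`□α` that must be handed on come from `◆◆x ≤ ◆x` and `□x ≤ □□x`; the remaining parts need only the
adjunction. -/
theorem acc_trace {J K : Ideal h.Lindenbaum} {p : ℕ} (ht : transForm p ∈ L)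
    (hJK : ∀ c, dia h c ∈ K → c ∈ J) : Acc m (h.trace m J) (h.trace m K) := fun k hk => by
  refine ⟨fun hm H => ?_, fun hm H => ?_⟩
  · rw [h.mem_trace_iff hk, h.mem_trace_iff hm, Form.ofNat_bdia, cls_bdia] at *
    intro H'
    exact H.elim (fun H => H (hJK _ H')) fun H => H (hJK _ (K.lower (h.dia_dia_le ht _) H'))
  · rw [h.mem_trace_iff hk, h.mem_trace_iff hm] at *
    rw [Form.ofNat_box, cls_box] at *
    refine ⟨fun H' => H (hJK _ (K.lower ((gc_dia_nec h).l_u_le _) H')), fun H' =>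
      H (J.lower (h.nec_le_nec_nec ht _) (hJK _ (K.lower ((gc_dia_nec h).l_u_le _) H')))⟩

/-- For the last four connectives, one direction takes a witness from the prime ideal lemmas and the
other follows from the definitions of `Incl` and `Acc`. -/
theorem coherent_trace {p : ℕ} (ht : transForm p ∈ L) {J : Ideal h.Lindenbaum} (hJ : J.IsPrime)
    {a b : ℕ} (ha : a < m) (hb : b < m) : Coherent m (h.traces m) (h.trace m J) a b := by
  have gc := gc_dia_nec h
  refine ⟨fun h0 => ?_, fun h1 => ?_, fun hm => ?_, fun hm => ?_, fun hm => ?_, fun hm => ?_,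
    fun hm => ?_, fun hm => ?_⟩
  · rw [h.mem_trace_iff h0]
    simpa [Form.ofNat, cls_top] using hJ.top_notMem'
  · rw [h.mem_trace_iff h1]
    simp [Form.ofNat, cls_bot]
  · simp only [h.mem_trace_iff hm, h.mem_trace_iff ha, h.mem_trace_iff hb, Form.ofNat_and, cls_and,
      hJ.inf_mem_iff, not_or]
  · simp only [h.mem_trace_iff hm, h.mem_trace_iff ha, h.mem_trace_iff hb, Form.ofNat_or, cls_or,
      Ideal.sup_mem_iff, not_and_or]
  · rw [h.forall_mem_traces]
    constructor
    · intro H K hK hJK hKa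
      -- `J` and `K` are compared only through their traces, but the implication itself has code
      -- below `m`, so it passes to `K`.
      have H' := hJK _ hm H
      rw [h.mem_trace_iff hm, Form.ofNat_imp, cls_imp] at H'
      rw [h.mem_trace_iff ha] at hKa
      rw [h.mem_trace_iff hb]
      intro hKb
      have := hK.inf_mem_iff.1 (K.lower (himp_inf_le (a := h.cls (Form.ofNat a))) hKb)
      exact this.elim H' hKa
    · intro H
      rw [h.mem_trace_iff hm, Form.ofNat_imp, cls_imp]
      intro H'
      obtain ⟨K, hK, hKJ, hKa, hKb⟩ := hJ.exists_of_himp_mem H'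
      exact (h.mem_trace_iff hb).1 (H K hK (h.incl_trace hKJ) ((h.mem_trace_iff ha).2 hKa)) hKb
  · rw [h.exists_mem_traces]
    constructor
    · intro H
      rw [h.mem_trace_iff hm, Form.ofNat_coimp, cls_coimp] at H
      obtain ⟨K, hK, hJK, hKa, hKb⟩ := Ideal.IsPrime.exists_of_sdiff_notMem H
      exact ⟨K, hK, h.incl_trace hJK, (h.mem_trace_iff ha).2 hKa,
        fun H' => (h.mem_trace_iff hb).1 H' hKb⟩
    · rintro ⟨K, hK, hKJ, hKa, hKb⟩
      refine hKJ _ hm ?_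
      rw [h.mem_trace_iff ha] at hKa
      rw [h.mem_trace_iff hb, not_not] at hKb
      rw [h.mem_trace_iff hm, Form.ofNat_coimp, cls_coimp]
      exact fun H => hKa (K.lower le_sup_sdiff (K.sup_mem hKb H))
  · rw [h.exists_mem_traces]
    constructor
    · intro H
      rw [h.mem_trace_iff hm, Form.ofNat_bdia, cls_bdia] at H
      obtain ⟨K, hK, hKa, hKJ⟩ := Ideal.IsPrime.exists_of_lowerAdjoint_notMem gc H
      exact ⟨K, hK, h.acc_trace ht hKJ, (h.mem_trace_iff ha).2 hKa⟩
    · rintro ⟨K, -, hKJ, hKa⟩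
      exact (hKJ a ha).1 hm (Or.inl hKa)
  · rw [h.forall_mem_traces]
    constructor
    · intro H K _ hJK
      exact ((hJK a ha).2 hm H).1
    · intro H
      rw [h.mem_trace_iff hm, Form.ofNat_box, cls_box]
      intro H'
      obtain ⟨K, hK, hKa, hJK⟩ := hJ.exists_of_upperAdjoint_mem gc H'
      -- The `□`-form of the canonical relation implies its `◆`-form by the unit `c ≤ □◆c`.
      exact (h.mem_trace_iff ha).1 (H K hK (h.acc_trace ht fun c hc =>
        J.lower (gc.le_u_l c) (hJK _ hc))) hKa

/-- The bound `φ.toNat + 1` puts `φ` itself in the filtration set. Traces are numbers below `2 ^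
(φ.toNat + 1)`, so a set of them has a code below the double exponential. -/
theorem exists_refutes (h : IsBistLogic L) {p : ℕ} (ht : transForm p ∈ L) {r : Bool}
    (hr : r = true → reflForm p ∈ L) {φ : Form} (hφ : φ ∉ L) :
    ∃ W < 2 ^ 2 ^ (φ.toNat + 1), Refutes r φ.toNat W := by
  refine ⟨h.traces (φ.toNat + 1), Nat.ofBits_lt_two_pow _, ?_, ?_⟩
  · refine h.forall_mem_traces.2 fun J hJ => ⟨fun hr' => h.acc_trace ht fun c hc => ?_,
      fun a ha b hb => h.coherent_trace ht hJ ha hb⟩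
    exact J.lower (h.le_dia (hr hr') c) hc
  · rw [h.exists_mem_traces]
    obtain ⟨J, hJ, hφJ⟩ := h.exists_isPrime_cls_mem hφ
    refine ⟨J, hJ, ?_⟩
    rwa [h.mem_trace_iff (Nat.lt_succ_self _), Form.ofNat_toNat, not_not]

end IsBistLogic

/-! ### Primitive recursiveness -/

section Primrec

variable {α : Type*} [Primcodable α]

theorem PrimrecPred.imp {p q : α → Prop} (hp : PrimrecPred p) (hq : PrimrecPred q) :
    PrimrecPred fun a => p a → q a :=
  (hp.not.or hq).of_eq fun _ => imp_iff_not_or.symm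

theorem PrimrecPred.iff {p q : α → Prop} (hp : PrimrecPred p) (hq : PrimrecPred q) :
    PrimrecPred fun a => p a ↔ q a :=
  ((hp.imp hq).and (hq.imp hp)).of_eq fun _ => iff_iff_implies_and_implies.symm

theorem PrimrecPred.ball_lt {f : α → ℕ} {p : α → ℕ → Prop} (hf : Primrec f)
    (hp : PrimrecPred fun x : ℕ × α => p x.2 x.1) : PrimrecPred fun a => ∀ x < f a, p a x :=
  ((PrimrecRel.forall_mem_list (R := fun x a => p a x) hp).comp
    (Primrec.list_range.comp hf) Primrec.id).of_eq fun _ => by simp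

theorem PrimrecPred.bex_lt {f : α → ℕ} {p : α → ℕ → Prop} (hf : Primrec f)
    (hp : PrimrecPred fun x : ℕ × α => p x.2 x.1) : PrimrecPred fun a => ∃ x < f a, p a x :=
  ((PrimrecRel.exists_mem_list (R := fun x a => p a x) hp).comp
    (Primrec.list_range.comp hf) Primrec.id).of_eq fun _ => by simp

theorem Primrec.two_pow {f : α → ℕ} (hf : Primrec f) : Primrec fun a => 2 ^ f a := by
  have h : Primrec fun n : ℕ => 2 ^ n := by
    refine (Primrec.nat_rec₁ 1 (f := fun _ y => y * 2)
      (Primrec.nat_mul.comp Primrec.snd (Primrec.const 2))).of_eq fun n => ?_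
    induction n with
    | zero => rfl
    | succ n ih => rw [pow_succ, ← ih]
  exact h.comp hf

theorem Primrec.seven_mul_add {f : α → ℕ} (hf : Primrec f) (k : ℕ) :
    Primrec fun a => 7 * f a + k :=
  Primrec.nat_add.comp (Primrec.nat_mul.comp (Primrec.const 7) hf) (Primrec.const k)

namespace ModelCode

variable {m W X Y a b : α → ℕ}

theorem primrecPred_mem (hX : Primrec X) (ha : Primrec a) :
    PrimrecPred fun x => Mem (X x) (a x) := by
  refine (Primrec.eq.comp (Primrec.nat_mod.comp (Primrec.nat_div.comp hX ha.two_pow)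
    (Primrec.const 2)) (Primrec.const 1)).of_eq fun x => ?_
  simp [Mem, Nat.testBit_eq_decide_div_mod_eq]

theorem primrecPred_incl (hm : Primrec m) (hX : Primrec X) (hY : Primrec Y) :
    PrimrecPred fun x => Incl (m x) (X x) (Y x) :=
  .ball_lt hm ((primrecPred_mem (hX.comp .snd) .fst).imp (primrecPred_mem (hY.comp .snd) .fst))

theorem primrecPred_acc (hm : Primrec m) (hX : Primrec X) (hY : Primrec Y) :
    PrimrecPred fun x => Acc (m x) (X x) (Y x) := by
  have hm' : Primrec fun x : ℕ × α => m x.2 := hm.comp .snd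
  have hX' : Primrec fun x : ℕ × α => X x.2 := hX.comp .snd
  have hY' : Primrec fun x : ℕ × α => Y x.2 := hY.comp .snd
  have hk : Primrec fun x : ℕ × α => x.1 := .fst
  refine .ball_lt hm (.and (.imp (Primrec.nat_lt.comp (hk.seven_mul_add 7) hm') (.imp (.or ?_ ?_)
    ?_)) (.imp (Primrec.nat_lt.comp (hk.seven_mul_add 8) hm') (.imp ?_ (.and ?_ ?_))))
  · exact primrecPred_mem hX' hk
  · exact primrecPred_mem hX' (hk.seven_mul_add 7)
  · exact primrecPred_mem hY' (hk.seven_mul_add 7)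
  · exact primrecPred_mem hX' (hk.seven_mul_add 8)
  · exact primrecPred_mem hY' hk
  · exact primrecPred_mem hY' (hk.seven_mul_add 8)

/-- Every quantifier over states is bounded by `2 ^ m`, so coherence is primitive recursive. -/
theorem primrecPred_coherent (hm : Primrec m) (hW : Primrec W) (hX : Primrec X) (ha : Primrec a)
    (hb : Primrec b) : PrimrecPred fun x => Coherent (m x) (W x) (X x) (a x) (b x) := by
  have hm' : Primrec fun x : ℕ × α => m x.2 := hm.comp .snd
  have hX' : Primrec fun x : ℕ × α => X x.2 := hX.comp .snd
  have hY : Primrec fun x : ℕ × α => x.1 := .fst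
  have hWY : PrimrecPred fun x : ℕ × α => Mem (W x.2) x.1 := primrecPred_mem (hW.comp .snd) hY
  have hYa : PrimrecPred fun x : ℕ × α => Mem x.1 (a x.2) := primrecPred_mem hY (ha.comp .snd)
  have hYb : PrimrecPred fun x : ℕ × α => Mem x.1 (b x.2) := primrecPred_mem hY (hb.comp .snd)
  have hab : Primrec fun x => Nat.pair (a x) (b x) := Primrec₂.natPair.comp ha hb
  have guard : ∀ {c : α → ℕ} {q : α → Prop}, Primrec c → PrimrecPred q →
      PrimrecPred fun x => c x < m x → (Mem (X x) (c x) ↔ q x) := fun hc hq =>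
    .imp (Primrec.nat_lt.comp hc hm) ((primrecPred_mem hX hc).iff hq)
  refine .and (.imp (Primrec.nat_lt.comp (.const 0) hm) (primrecPred_mem hX (.const 0)))
    (.and (.imp (Primrec.nat_lt.comp (.const 1) hm) (primrecPred_mem hX (.const 1)).not)
    (.and (guard (hab.seven_mul_add 3) ((primrecPred_mem hX ha).and (primrecPred_mem hX hb)))
    (.and (guard (hab.seven_mul_add 4) ((primrecPred_mem hX ha).or (primrecPred_mem hX hb)))
    (.and (guard (hab.seven_mul_add 5) (.ball_lt hm.two_pow ?_))
    (.and (guard (hab.seven_mul_add 6) (.bex_lt hm.two_pow ?_))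
    (.and (guard (ha.seven_mul_add 7) (.bex_lt hm.two_pow ?_))
    (guard (ha.seven_mul_add 8) (.ball_lt hm.two_pow ?_))))))))
  · exact hWY.imp ((primrecPred_incl hm' hX' hY).imp (hYa.imp hYb))
  · exact hWY.and ((primrecPred_incl hm' hY hX').and (hYa.and hYb.not))
  · exact hWY.and ((primrecPred_acc hm' hY hX').and hYa)
  · exact hWY.imp ((primrecPred_acc hm' hX' hY).imp hYa)

theorem primrecPred_isModel (r : Bool) (hm : Primrec m) (hW : Primrec W) :
    PrimrecPred fun x => IsModel r (m x) (W x) := by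
  -- Each bounded quantifier prepends its variable, so the innermost tuples are `(b, a, X, x)`.
  have hm1 : Primrec fun x : ℕ × α => m x.2 := hm.comp .snd
  have hm2 : Primrec fun x : ℕ × ℕ × α => m x.2.2 := hm1.comp .snd
  have hm3 : Primrec fun x : ℕ × ℕ × ℕ × α => m x.2.2.2 := hm2.comp .snd
  have hW1 : Primrec fun x : ℕ × α => W x.2 := hW.comp .snd
  have hW3 : Primrec fun x : ℕ × ℕ × ℕ × α => W x.2.2.2 := (hW1.comp .snd).comp .snd
  have hX1 : Primrec fun x : ℕ × α => x.1 := .fst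
  have hX3 : Primrec fun x : ℕ × ℕ × ℕ × α => x.2.2.1 := (hX1.comp .snd).comp .snd
  refine .ball_lt hm.two_pow (.imp (primrecPred_mem hW1 hX1) (.and
    (.imp (Primrec.eq.comp (.const r) (.const true)) (primrecPred_acc hm1 hX1 hX1))
    (.ball_lt hm1 (.ball_lt hm2 ?_))))
  exact primrecPred_coherent hm3 hW3 hX3 (Primrec.fst.comp .snd) .fst

theorem primrecPred_refutes (r : Bool) {n : α → ℕ} (hn : Primrec n) (hW : Primrec W) :
    PrimrecPred fun x => Refutes r (n x) (W x) := by
  have hm : Primrec fun x => n x + 1 := Primrec.succ.comp hn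
  refine .and (primrecPred_isModel r hm hW) (.bex_lt hm.two_pow
    (.and (primrecPred_mem (hW.comp .snd) .fst) (primrecPred_mem .fst (hn.comp .snd)).not))

end ModelCode

end Primrec

/-! ### The finite model property and decidability -/

theorem isBistLogic_biSKt (S : Set Form) : IsBistLogic (BiSKt S) where
  ax φ hφ _ hL := hL.1.ax φ hφ
  mp φ ψ h1 h2 L hL := hL.1.mp φ ψ (h1 L hL) (h2 L hL)
  us φ σ h L hL := hL.1.us φ σ (h L hL)
  monCoimp δ₁ δ₂ ψ h L hL := hL.1.monCoimp δ₁ δ₂ ψ (h L hL)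
  monBox φ ψ h L hL := hL.1.monBox φ ψ (h L hL)
  monBdia φ ψ h L hL := hL.1.monBdia φ ψ (h L hL)

theorem subset_biSKt (S : Set Form) : S ⊆ BiSKt S := fun _ hφ _ hL => hL.2 hφ

theorem HFrame.valid_of_mem_biSKt {S : Set Form} (F : HFrame) (hS : ∀ φ ∈ S, F.Valid φ) :
    ∀ φ ∈ BiSKt S, F.Valid φ :=
  fun _ hφ => hφ {ψ | F.Valid ψ} ⟨F.isBistLogic_valid, hS⟩

/-- A `bist`-logic with `◆◆p → ◆p` (and `p → ◆p`, if `r` holds) that is sound for the transitive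
(and reflexive, if `r` holds) frames has the finite model property and is decidable. -/
theorem IsBistLogic.hasFMP_and_isDecidableLogic {L : Set Form} (h : IsBistLogic L) {p : ℕ}
    (ht : transForm p ∈ L) (r : Bool) (hr : r = true → reflForm p ∈ L)
    (sound : ∀ F : HFrame, (∀ u v w, F.R u v → F.R v w → F.R u w) → (r = true → ∀ u, F.R u u) →
      ∀ φ ∈ L, F.Valid φ) : HasFMP L ∧ IsDecidableLogic L := by
  have fmp : ∀ φ : Form, ∀ W, ModelCode.Refutes r φ.toNat W →
      ∃ F : HFrame, Finite F.U ∧ (∀ ψ ∈ L, F.Valid ψ) ∧ ¬ F.Valid φ := fun φ W hW => by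
    obtain ⟨F, hF, hFt, hFr, hv⟩ := hW.exists_frame
    exact ⟨F, hF, sound F hFt hFr, hv⟩
  refine ⟨fun φ hφ => ?_, ?_⟩
  · obtain ⟨W, -, hW⟩ := h.exists_refutes ht hr hφ
    exact fmp φ W hW
  · have henc : Primrec fun φ : Form => φ.toNat := Primrec.encode
    have hbound : Primrec fun φ : Form => 2 ^ 2 ^ (φ.toNat + 1) :=
      (Primrec.succ.comp henc).two_pow.two_pow
    -- Theorems are exactly the formulas with no refuting code below the bound: completeness
    -- supplies such a code for a nontheorem, and soundness excludes one for a theorem.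
    refine (PrimrecPred.bex_lt (p := fun φ W => ModelCode.Refutes r φ.toNat W) hbound
      (ModelCode.primrecPred_refutes r (henc.comp .snd) .fst)).not.computablePred.of_eq
      fun φ => ⟨fun H => ?_, ?_⟩
    · by_contra hφ
      exact H (h.exists_refutes ht hr hφ)
    · rintro hφ ⟨W, -, hW⟩
      obtain ⟨F, -, hL, hv⟩ := fmp φ W hW
      exact hv (hL φ hφ)

theorem theorem5 (p : ℕ) :
    (HasFMP (BiSKt {transForm p}) ∧ IsDecidableLogic (BiSKt {transForm p})) ∧
    (HasFMP (BiSKt {transForm p, reflForm p}) ∧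
      IsDecidableLogic (BiSKt {transForm p, reflForm p})) := by
  refine ⟨(isBistLogic_biSKt _).hasFMP_and_isDecidableLogic (p := p)
      (subset_biSKt _ (by simp)) false (by simp) fun F hFt _ => F.valid_of_mem_biSKt ?_,
    (isBistLogic_biSKt _).hasFMP_and_isDecidableLogic (p := p)
      (subset_biSKt _ (by simp)) true (fun _ => subset_biSKt _ (by simp))
      fun F hFt hFr => F.valid_of_mem_biSKt ?_⟩
  · rintro φ rfl
    exact F.valid_transForm hFt p
  · rintro φ (rfl | rfl)
    · exact F.valid_transForm hFt p
    · exact F.valid_reflForm (hFr rfl) p
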